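/- Let $n\ge 1$ and let $\mathbb{E}^n$ be Euclidean $n$-space. A convex body is a nonempty compact convex set $K\subset\mathbb{R}^n$ (possibly with empty interior). Write $B(c,\rho)$ for the closed ball with centre $c$ and radius $\rho$, $D(K)$ for the diameter of $K$, and $$R(K)=\inf\{\rho>0:\exists c,\ K\subset B(c,\rho)\},\qquad r(K)=\sup\{\rho>0:\exists c,\ B(c,\rho)\subset K\},$$ $$s(K)=\inf\{\rho>0:\exists c\in\mathbb{R}^n,\ -K\subset c+\rho K\},$$ where $\sup\emptyset=0$, so that $r(K)=0$ if $K$ has empty interior. A convex body $K$ is complete if $D(K\cup\{x\})>D(K)$ for all $x\notin K$. A completion of $K$ is a complete convex body $K^*\supset K$ with $D(K^*)=D(K)$. The pseudo-completion of $K$ is $K^+=\operatorname{conv}\bigl(K\cup B(c,D(K)-R(K))\bigr)$, where $c$ is the circumcenter of $K$, i.e. $K\subset B(c,R(K))$. Let $$j(\mathbb{E}^n)=\sup_{K} \frac{R(K)}{D(K)},\qquad s(\mathbb{E}^n)=\max_{K\text{ complete}} s(K),$$ where the supremum is over all convex bodies $K$ with more than one point and the maximum over all complete convex bodies. Then the supremum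 is finite, the maximum is attained, and $$s(\mathbb{E}^n)=\frac{j(\mathbb{E}^n)}{1-j(\mathbb{E}^n)}=\frac{n+\sqrt{2n(n+1)}}{n+2}.$$ Moreover, a convex body $K$ satisfies $s(K)=s(\mathbb{E}^n)$ and $R(K)+r(K)=D(K)$ if and only if there are a regular $n$-simplex $T$ and a completion $T^*$ of $T$ such that $T^+\subset K\subset T^*$. In particular, a convex body $K$ of constant width (i.e. with $\max_{x\in K-K}u^{T}x$ the same for all unit vectors $u$) satisfies $s(K)=s(\mathbb{E}^n)$ if and only if $K$ is a completion of a regular $n$-simplex. -/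

import Mathlib

open scoped Pointwise

/-! Radii, asymmetry and completeness in a real normed space `E`.  Diameters are `Metric.diam`, and
convex bodies are Mathlib's `ConvexBody E`: nonempty compact convex sets, possibly with empty
interior. -/

noncomputable section

namespace MinkowskiGeometry

variable {E : Type*} [NormedAddCommGroup E] [NormedSpace ℝ E]

/-- The Minkowski asymmetry `s(K)`. -/
def asymmetry (K : Set E) : ℝ :=
  sInf {ρ : ℝ | 0 < ρ ∧ ∃ c : E, -K ⊆ c +ᵥ ρ • K}

/-- The circumradius `R(K)`. -/
def outerRadius (K : Set E) : ℝ :=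
  sInf {ρ : ℝ | 0 < ρ ∧ ∃ c : E, K ⊆ Metric.closedBall c ρ}

/-- The inradius `r(K)`; it is `0` (the supremum of the empty set) if `K` has empty interior. -/
def innerRadius (K : Set E) : ℝ :=
  sSup {ρ : ℝ | 0 < ρ ∧ ∃ c : E, Metric.closedBall c ρ ⊆ K}

/-- The Jung ratio `j(K) = R(K) / D(K)`, meaningful if `D(K) > 0`. -/
def jungRatio (K : Set E) : ℝ :=
  outerRadius K / Metric.diam K

/-- The Jung ratios of the convex bodies (with more than one point) of the space `E`. -/
def jungRatios (E : Type*) [NormedAddCommGroup E] [NormedSpace ℝ E] : Set ℝ :=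
  {t : ℝ | ∃ K : ConvexBody E, 0 < Metric.diam (K : Set E) ∧ t = jungRatio (K : Set E)}

/-- The Jung constant `j(E)` of the space `E`. -/
def jungConstant (E : Type*) [NormedAddCommGroup E] [NormedSpace ℝ E] : ℝ :=
  sSup (jungRatios E)

/-- `K` is (diametrically) complete: adding any point enlarges its diameter. -/
def DiamComplete (K : Set E) : Prop :=
  ∀ x : E, x ∉ K → Metric.diam K < Metric.diam (K ∪ {x})

/-- The convex body `C` is a completion of the set `A`. -/
def IsCompletion (A : Set E) (C : ConvexBody E) : Prop :=
  A ⊆ C ∧ DiamComplete (C : Set E) ∧ Metric.diam (C : Set E) = Metric.diam A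

/-- The Minkowski asymmetries of the complete convex bodies of the space `E`. -/
def completeAsymmetries (E : Type*) [NormedAddCommGroup E] [NormedSpace ℝ E] : Set ℝ :=
  {t : ℝ | ∃ K : ConvexBody E, DiamComplete (K : Set E) ∧ t = asymmetry (K : Set E)}

/-- The asymmetry constant `s(E)` of the space `E`. -/
def asymmetryConstant (E : Type*) [NormedAddCommGroup E] [NormedSpace ℝ E] : ℝ :=
  sSup (completeAsymmetries E)

/-- `c` is a circumcenter of `K`. -/
def IsCircumcenter (K : Set E) (c : E) : Prop :=
  K ⊆ Metric.closedBall c (outerRadius K)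

/-- `P` is a pseudo-completion `K⁺` of `K`. -/
def IsPseudoCompletion (K P : Set E) : Prop :=
  ∃ c : E, IsCircumcenter K c ∧
    P = convexHull ℝ (K ∪ Metric.closedBall c (Metric.diam K - outerRadius K))

/-- The support function `h(K, f)`, with directions given by linear functionals. -/
def supportFn (K : Set E) (f : E →L[ℝ] ℝ) : ℝ :=
  sSup (f '' K)

/-- `K` has constant width: `h(K - K, f) / h(B, f)` is the same for all directions `f ≠ 0`, where
`B` is the unit ball. -/
def ConstantWidth (K : Set E) : Prop :=
  ∃ w : ℝ, ∀ f : E →L[ℝ] ℝ, f ≠ 0 →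
    supportFn (K - K) f / supportFn (Metric.closedBall (0 : E) 1) f = w

/-- `T` is a regular `n`-dimensional simplex (as a solid body) in Euclidean `n`-space. -/
def IsRegularSimplex {n : ℕ} (T : Set (EuclideanSpace ℝ (Fin n))) : Prop :=
  ∃ S : Affine.Simplex ℝ (EuclideanSpace ℝ (Fin n)) n,
    S.Regular ∧ T = convexHull ℝ (Set.range S.points)

end MinkowskiGeometry

end

open MinkowskiGeometry

/-! Write D, R, r for the diameter, circumradius and inradius of K, and j for `jungNumber n`.

Upper bound: always R + r ≤ D, and equality forces inball and circumball to be concentric. Then -K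
lies in a translate of (R/r)K, so s(K) ≤ R/(D - R). Jung's theorem R ≤ jD (`jung`) turns this into
s(K) ≤ j/(1 - j). Complete bodies satisfy R + r = D, since the ball of radius D - R about a
circumcenter lies in K.

Lower bound: suppose K contains the vertices of a regular simplex with edge D, and -K lies in a
translate of ρK. Then the vertices lie in a ball of radius ρD/(1 + ρ), which must be at least jD, so
ρ ≥ j/(1 - j) (`jungNumber_div_le_of_neg_subset`). Completions of a regular simplex therefore attain
the maximum.

Extremal bodies: s(K) = j/(1 - j) together with R + r = D gives equality in Jung's theorem, and
hence a regular simplex T in K with edge D. Now T and K share D and R. The concentric balls put a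
pseudo-completion of T inside K, and any completion of K is a completion of T. Bodies of constant
width are complete, so the last claim is a special case. -/

namespace MinkowskiGeometry

/-! ### Circumballs and diametric completeness. -/

section Metric

variable {E : Type*} [NormedAddCommGroup E]

lemma outerRadius_nonneg (K : Set E) : 0 ≤ outerRadius K :=
  Real.sInf_nonneg fun _ h => h.1.le

lemma innerRadius_nonneg (K : Set E) : 0 ≤ innerRadius K :=
  Real.sSup_nonneg fun _ h => h.1.le

lemma outerRadius_le {K : Set E} {c : E} {ρ : ℝ} (hρ : 0 ≤ ρ) (h : K ⊆ Metric.closedBall c ρ) :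
    outerRadius K ≤ ρ := by
  refine le_of_forall_pos_le_add fun ε hε => ?_
  -- Only positive radii are admitted in the infimum, so ρ = 0 is reached through ρ + ε.
  exact csInf_le ⟨0, fun _ h => h.1.le⟩
    ⟨by linarith, c, h.trans (Metric.closedBall_subset_closedBall (by linarith))⟩

/-- A bounded nonempty set has a circumcenter. -/
lemma exists_isCircumcenter [ProperSpace E] {K : Set E} (hb : Bornology.IsBounded K)
    (hne : K.Nonempty) : ∃ c, IsCircumcenter K c := by
  obtain ⟨x₀, hx₀⟩ := hne
  have key : ∀ k : ℕ, ∃ c, K ⊆ Metric.closedBall c (outerRadius K + 1 / ((k : ℝ) + 1)) := by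
    intro k
    have hne : {ρ : ℝ | 0 < ρ ∧ ∃ c : E, K ⊆ Metric.closedBall c ρ}.Nonempty :=
      ⟨Metric.diam K + 1, by positivity, x₀, fun y hy =>
        (Metric.dist_le_diam_of_mem hb hy hx₀).trans (by simp)⟩
    obtain ⟨ρ, ⟨_, c, hc⟩, h⟩ := exists_lt_of_csInf_lt hne
      (show outerRadius K < outerRadius K + 1 / ((k : ℝ) + 1) by
        have : 0 < 1 / ((k : ℝ) + 1) := by positivity
        linarith)
    exact ⟨c, hc.trans (Metric.closedBall_subset_closedBall h.le)⟩
  choose u hu using key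
  have hmem : ∀ k, u k ∈ Metric.closedBall x₀ (outerRadius K + 1) := by
    intro k
    have h1 := hu k hx₀
    rw [Metric.mem_closedBall, dist_comm] at h1
    rw [Metric.mem_closedBall]
    have : 1 / ((k : ℝ) + 1) ≤ 1 := by
      rw [div_le_one (by positivity)]; linarith [(Nat.cast_nonneg k : (0 : ℝ) ≤ k)]
    linarith
  obtain ⟨c, _, φ, hφ, hc⟩ := (isCompact_closedBall x₀ (outerRadius K + 1)).tendsto_subseq hmem
  refine ⟨c, fun x hx => ?_⟩
  have h1 : Filter.Tendsto (fun k => dist x (u (φ k))) Filter.atTop (nhds (dist x c)) :=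
    tendsto_const_nhds.dist hc
  have h2 : Filter.Tendsto (fun k => outerRadius K + 1 / (((φ k : ℕ) : ℝ) + 1)) Filter.atTop
      (nhds (outerRadius K + 0)) :=
    tendsto_const_nhds.add (tendsto_one_div_add_atTop_nhds_zero_nat.comp hφ.tendsto_atTop)
  rw [add_zero] at h2
  exact le_of_tendsto_of_tendsto' h1 h2 fun k => hu (φ k) hx

lemma outerRadius_pos {K : Set E} (hK : 0 < Metric.diam K) : 0 < outerRadius K := by
  have hb : Bornology.IsBounded K := by
    by_contra h
    exact hK.ne' (Metric.diam_eq_zero_of_unbounded h)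
  obtain ⟨B, hB⟩ := hb.subset_closedBall (0 : E)
  refine (half_pos hK).trans_le (le_csInf ⟨max B 1, by positivity, 0, hB.trans ?_⟩ ?_)
  · exact Metric.closedBall_subset_closedBall (le_max_left _ _)
  · rintro ρ ⟨hρ, c, hc⟩
    have := (Metric.diam_mono hc Metric.isBounded_closedBall).trans
      (Metric.diam_closedBall hρ.le)
    linarith

lemma DiamComplete.mem_of_dist_le {K : Set E} (hK : DiamComplete K) (hb : Bornology.IsBounded K)
    {y : E} (hy : ∀ x ∈ K, dist y x ≤ Metric.diam K) : y ∈ K := by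
  by_contra hyK
  refine (hK y hyK).not_ge (Metric.diam_le_of_forall_dist_le Metric.diam_nonneg ?_)
  rintro p (hp | rfl) q (hq | rfl)
  · exact Metric.dist_le_diam_of_mem hb hp hq
  · rw [dist_comm]; exact hy p hp
  · exact hy q hq
  · simpa using Metric.diam_nonneg

/-- By the triangle inequality through c, every point of the smaller ball is within D of all of K,
so completeness absorbs it. This is the source of R + r = D. -/
lemma DiamComplete.closedBall_subset {K : Set E} (hK : DiamComplete K)
    (hb : Bornology.IsBounded K) {c : E} {R : ℝ} (h : K ⊆ Metric.closedBall c R) :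
    Metric.closedBall c (Metric.diam K - R) ⊆ K := by
  intro y hy
  refine hK.mem_of_dist_le hb fun x hx => ?_
  have h1 : dist x c ≤ R := h hx
  have h2 : dist y c ≤ Metric.diam K - R := hy
  linarith [dist_triangle_right y x c]

end Metric

/-! ### Circumradius plus inradius against the diameter; asymmetry; completions. -/

section Radii

variable {E : Type*} [NormedAddCommGroup E] [NormedSpace ℝ E]

/-- A set of diameter `D` containing a ball of radius `ρ` lies in the concentric ball of radius
`D - ρ`. -/
lemma subset_closedBall_diam_sub [Nontrivial E] {K : Set E} (hb : Bornology.IsBounded K) {c : E}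
    {ρ : ℝ} (hρ : 0 ≤ ρ) (h : Metric.closedBall c ρ ⊆ K) :
    K ⊆ Metric.closedBall c (Metric.diam K - ρ) := by
  intro x hx
  rw [mem_closedBall_iff_norm]
  rcases eq_or_ne x c with rfl | hxc
  · obtain ⟨v, hv⟩ := exists_norm_eq E hρ
    have h1 : x + v ∈ K := h (by simp [hv])
    have := Metric.dist_le_diam_of_mem hb h1 hx
    simp [hv] at this
    simpa using this
  · have hpos : 0 < ‖x - c‖ := norm_pos_iff.2 (sub_ne_zero.2 hxc)
    -- The point of the ball opposite to x has distance ‖x - c‖ + ρ from x.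
    have h1 : c - (ρ / ‖x - c‖) • (x - c) ∈ K := by
      apply h
      rw [mem_closedBall_iff_norm, sub_sub_cancel_left, norm_neg, norm_smul, Real.norm_of_nonneg
        (by positivity), div_mul_cancel₀ _ hpos.ne']
    have h2 := Metric.dist_le_diam_of_mem hb hx h1
    have h3 : x - (c - (ρ / ‖x - c‖) • (x - c)) = (1 + ρ / ‖x - c‖) • (x - c) := by
      module
    rw [dist_eq_norm, h3, norm_smul, Real.norm_of_nonneg (by positivity), add_mul,
      div_mul_cancel₀ _ hpos.ne'] at h2
    linarith

lemma bddAbove_inradii [Nontrivial E] {K : Set E} (hb : Bornology.IsBounded K) :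
    BddAbove {ρ : ℝ | 0 < ρ ∧ ∃ c : E, Metric.closedBall c ρ ⊆ K} := by
  refine ⟨Metric.diam K, ?_⟩
  rintro ρ ⟨hρ, c, hc⟩
  have := subset_closedBall_diam_sub hb hρ.le hc (hc (Metric.mem_closedBall_self hρ.le))
  simpa using this

lemma le_innerRadius [Nontrivial E] {K : Set E} (hb : Bornology.IsBounded K) {c : E} {ρ : ℝ}
    (h : Metric.closedBall c ρ ⊆ K) : ρ ≤ innerRadius K := by
  rcases le_or_gt ρ 0 with hρ | hρ
  · exact hρ.trans (innerRadius_nonneg K)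
  · exact le_csSup (bddAbove_inradii hb) ⟨hρ, c, h⟩

/-- A nonempty compact set contains a ball of radius `r(K)`. -/
lemma exists_closedBall_innerRadius_subset [ProperSpace E] [Nontrivial E] {K : Set E}
    (hK : IsCompact K) (hne : K.Nonempty) : ∃ c, Metric.closedBall c (innerRadius K) ⊆ K := by
  rcases (innerRadius_nonneg K).eq_or_lt with h0 | h0
  · obtain ⟨x, hx⟩ := hne
    exact ⟨x, by rw [← h0]; simpa using hx⟩
  have hS : {ρ : ℝ | 0 < ρ ∧ ∃ c : E, Metric.closedBall c ρ ⊆ K}.Nonempty := by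
    by_contra hS
    rw [Set.not_nonempty_iff_eq_empty] at hS
    rw [innerRadius, hS, Real.sSup_empty] at h0
    exact h0.false
  have key : ∀ k : ℕ, ∃ c ∈ K, Metric.closedBall c (innerRadius K - 1 / ((k : ℝ) + 1)) ⊆ K := by
    intro k
    obtain ⟨ρ, ⟨hρ, c, hc⟩, h⟩ := exists_lt_of_lt_csSup hS
      (show innerRadius K - 1 / ((k : ℝ) + 1) < innerRadius K by
        have : 0 < 1 / ((k : ℝ) + 1) := by positivity
        linarith)
    exact ⟨c, hc (Metric.mem_closedBall_self hρ.le),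
      (Metric.closedBall_subset_closedBall h.le).trans hc⟩
  choose u huK hu using key
  obtain ⟨c, _, φ, hφ, hc⟩ := hK.tendsto_subseq huK
  refine ⟨c, ?_⟩
  -- A point of the open limit ball lies in one of the approximating balls; closedness of K supplies
  -- the boundary.
  rw [← closure_ball c h0.ne']
  refine hK.isClosed.closure_subset_iff.2 fun x hx => ?_
  have h1 : Filter.Tendsto (fun k => dist x (u (φ k))) Filter.atTop (nhds (dist x c)) :=
    tendsto_const_nhds.dist hc
  have h2 : Filter.Tendsto (fun k => innerRadius K - 1 / (((φ k : ℕ) : ℝ) + 1)) Filter.atTop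
      (nhds (innerRadius K - 0)) :=
    tendsto_const_nhds.sub (tendsto_one_div_add_atTop_nhds_zero_nat.comp hφ.tendsto_atTop)
  rw [sub_zero] at h2
  obtain ⟨k, hk⟩ := (h1.eventually_lt h2 hx).exists
  exact hu _ hk.le

lemma outerRadius_add_innerRadius_le [ProperSpace E] [Nontrivial E] {K : Set E} (hK : IsCompact K)
    (hne : K.Nonempty) : outerRadius K + innerRadius K ≤ Metric.diam K := by
  obtain ⟨c, hc⟩ := exists_closedBall_innerRadius_subset hK hne
  have h := subset_closedBall_diam_sub hK.isBounded (innerRadius_nonneg K) hc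
  have h0 : 0 ≤ Metric.diam K - innerRadius K := by
    obtain ⟨x, hx⟩ := hne
    exact dist_nonneg.trans (h hx)
  linarith [outerRadius_le h0 h]

/-- With c as origin, -K lies in the ball of radius R, which is R/r times the ball of radius r
inside K. -/
lemma exists_neg_subset_vadd_smul {K : Set E} {c : E} {r R : ℝ} (hr : 0 < r) (hR : 0 < R)
    (h₁ : Metric.closedBall c r ⊆ K) (h₂ : K ⊆ Metric.closedBall c R) :
    ∃ a : E, -K ⊆ a +ᵥ (R / r) • K := by
  refine ⟨-((R / r) • c) - c, fun y hy => ?_⟩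
  have hy' : ‖-y - c‖ ≤ R := mem_closedBall_iff_norm.1 (h₂ (Set.mem_neg.1 hy))
  have hk : c + (r / R) • (c + y) ∈ K := by
    apply h₁
    rw [mem_closedBall_iff_norm, add_sub_cancel_left, norm_smul, Real.norm_of_nonneg
      (by positivity), show c + y = -(-y - c) by abel, norm_neg]
    calc r / R * ‖-y - c‖ ≤ r / R * R := by gcongr
      _ = r := by field_simp
  rw [Set.mem_vadd_set]
  refine ⟨(R / r) • (c + (r / R) • (c + y)), Set.smul_mem_smul_set hk, ?_⟩
  rw [smul_add, smul_smul, show R / r * (r / R) = 1 by field_simp, one_smul, vadd_eq_add]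
  abel

lemma asymmetry_le {K : Set E} {a : E} {ρ : ℝ} (hρ : 0 < ρ) (h : -K ⊆ a +ᵥ ρ • K) :
    asymmetry K ≤ ρ :=
  csInf_le ⟨0, fun _ h => h.1.le⟩ ⟨hρ, a, h⟩

/-- If circumradius and inradius add up to the diameter then circumball and inball are
concentric. -/
lemma exists_concentric_balls [ProperSpace E] [Nontrivial E] {K : Set E} (hK : IsCompact K)
    (hne : K.Nonempty) (h : outerRadius K + innerRadius K = Metric.diam K) :
    ∃ c, Metric.closedBall c (innerRadius K) ⊆ K ∧ K ⊆ Metric.closedBall c (outerRadius K) := by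
  obtain ⟨c, hc⟩ := exists_closedBall_innerRadius_subset hK hne
  have h' := subset_closedBall_diam_sub hK.isBounded (innerRadius_nonneg K) hc
  rw [← h, add_sub_cancel_right] at h'
  exact ⟨c, hc, h'⟩

lemma DiamComplete.outerRadius_add_innerRadius [ProperSpace E] [Nontrivial E] {K : Set E}
    (hK : DiamComplete K) (hc : IsCompact K) (hne : K.Nonempty) :
    outerRadius K + innerRadius K = Metric.diam K := by
  refine (outerRadius_add_innerRadius_le hc hne).antisymm ?_
  obtain ⟨c, h⟩ := exists_isCircumcenter hc.isBounded hne
  linarith [le_innerRadius hc.isBounded (hK.closedBall_subset hc.isBounded h)]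

/-- Every convex body has a completion. -/
lemma exists_isCompletion [ProperSpace E] (K : ConvexBody E) :
    ∃ C : ConvexBody E, IsCompletion (K : Set E) C := by
  set D := Metric.diam (K : Set E) with hD
  have hKS : (K : Set E) ∈ {A : Set E | ∀ x ∈ A, ∀ y ∈ A, dist x y ≤ D} := fun x hx y hy =>
    Metric.dist_le_diam_of_mem K.isCompact.isBounded hx hy
  -- The family is given by pairwise distances, because `Metric.diam` is 0 on unbounded sets. A
  -- maximal member equals its closed convex hull, which has the same diameter.
  obtain ⟨M, hKM, hM⟩ := zorn_subset_nonempty {A : Set E | ∀ x ∈ A, ∀ y ∈ A, dist x y ≤ D} (by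
    intro c hc hchain _
    refine ⟨⋃₀ c, ?_, fun s hs => Set.subset_sUnion_of_mem hs⟩
    rintro x ⟨s, hs, hx⟩ y ⟨t, ht, hy⟩
    rcases hchain.total hs ht with h | h
    · exact hc ht x (h hx) y hy
    · exact hc hs x hx y (h hy)) _ hKS
  have hMb : Bornology.IsBounded M := Metric.isBounded_iff.2 ⟨D, fun x hx y hy => hM.1 x hx y hy⟩
  have hMne : M.Nonempty := K.nonempty.mono hKM
  have hdiam : Metric.diam M = D := by
    refine le_antisymm (Metric.diam_le_of_forall_dist_le Metric.diam_nonneg hM.1) ?_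
    exact Metric.diam_mono hKM hMb
  have hclosed : closure (convexHull ℝ M) ⊆ M := by
    refine hM.2 (fun x hx y hy => ?_) ((subset_convexHull ℝ M).trans subset_closure)
    have := Metric.dist_le_diam_of_mem (isBounded_convexHull.2 hMb).closure hx hy
    rwa [Metric.diam_closure, convexHull_diam, hdiam] at this
  have hM' : closure (convexHull ℝ M) = M :=
    hclosed.antisymm ((subset_convexHull ℝ M).trans subset_closure)
  refine ⟨⟨M, ?_, ?_, hMne⟩, hKM, ?_, hdiam⟩
  · rw [← hM']; exact (convex_convexHull ℝ M).closure
  · exact Metric.isCompact_of_isClosed_isBounded (hM' ▸ isClosed_closure) hMb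
  · intro x hx
    change Metric.diam M < Metric.diam (M ∪ {x})
    rw [hdiam]
    by_contra! hle
    refine hx (hM.2 (y := M ∪ {x}) (fun p hp q hq => ?_) Set.subset_union_left
      (Set.mem_union_right _ rfl))
    exact (Metric.dist_le_diam_of_mem (hMb.union Bornology.isBounded_singleton) hp hq).trans hle

end Radii

/-! ### Constant width implies completeness. -/

section ConstantWidth

variable {E : Type*} [NormedAddCommGroup E] [NormedSpace ℝ E]

lemma supportFn_closedBall (f : E →L[ℝ] ℝ) :
    supportFn (Metric.closedBall (0 : E) 1) f = ‖f‖ := by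
  have hle : ∀ x ∈ Metric.closedBall (0 : E) 1, f x ≤ ‖f‖ := fun x hx =>
    (le_abs_self _).trans (f.unit_le_opNorm x (by simpa using hx))
  have hbdd : BddAbove (f '' Metric.closedBall (0 : E) 1) :=
    ⟨‖f‖, by rintro _ ⟨x, hx, rfl⟩; exact hle x hx⟩
  have hne : (Metric.closedBall (0 : E) 1).Nonempty := ⟨0, by simp⟩
  refine le_antisymm (csSup_le (hne.image _) ?_) ?_
  · rintro _ ⟨x, hx, rfl⟩; exact hle x hx
  · rw [← f.sSup_unitClosedBall_eq_norm]
    refine csSup_le (hne.image _) ?_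
    rintro _ ⟨x, hx, rfl⟩
    change |f x| ≤ _
    refine abs_le'.2 ⟨le_csSup hbdd ⟨x, hx, rfl⟩, le_csSup hbdd ⟨-x, ?_, by simp⟩⟩
    simpa using hx

/-- Convex bodies of constant width are complete. -/
lemma ConstantWidth.diamComplete [Nontrivial E] {K : ConvexBody E}
    (hK : ConstantWidth (K : Set E)) : DiamComplete (K : Set E) := by
  obtain ⟨w, hw⟩ := hK
  have hcpt : IsCompact ((K : Set E) - (K : Set E)) := by
    rw [sub_eq_add_neg]
    exact K.isCompact.add K.isCompact.neg
  have hw' : ∀ f : E →L[ℝ] ℝ, f ≠ 0 → supportFn ((K : Set E) - (K : Set E)) f = w * ‖f‖ := by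
    intro f hf
    rw [← hw f hf, supportFn_closedBall, div_mul_cancel₀ _ (norm_ne_zero_iff.2 hf)]
  have hle : ∀ f : E →L[ℝ] ℝ, f ≠ 0 → ∀ x ∈ (K : Set E), ∀ y ∈ (K : Set E),
      f (x - y) ≤ w * ‖f‖ := by
    intro f hf x hx y hy
    rw [← hw' f hf]
    exact le_csSup (hcpt.image f.continuous).bddAbove ⟨_, Set.sub_mem_sub hx hy, rfl⟩
  have hdist : ∀ x ∈ (K : Set E), ∀ y ∈ (K : Set E), dist x y ≤ w := by
    intro x hx y hy
    obtain ⟨f, hf, hfx⟩ := exists_dual_vector' ℝ (x - y)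
    have := hle f (norm_ne_zero_iff.1 (by simp [hf])) x hx y hy
    rw [hfx, hf, mul_one] at this
    simpa [dist_eq_norm] using this
  have hw0 : 0 ≤ w := by
    obtain ⟨x, hx⟩ := K.nonempty
    exact dist_nonneg.trans (hdist x hx x hx)
  have hdiam : Metric.diam (K : Set E) ≤ w := Metric.diam_le_of_forall_dist_le hw0 hdist
  intro y hy
  -- Let f separate y from K and let p - q realise the width w‖f‖ in direction f. Then f y > f p, so
  -- y is farther than w from q.
  obtain ⟨f, u, hfK, hfy⟩ := geometric_hahn_banach_closed_point K.convex K.isClosed hy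
  have hf : f ≠ 0 := by
    rintro rfl
    obtain ⟨x, hx⟩ := K.nonempty
    have := hfK x hx
    simp at this hfy
    linarith
  obtain ⟨_, ⟨p, hp, q, hq, rfl⟩, hmax⟩ := hcpt.exists_isMaxOn
    (K.nonempty.sub K.nonempty) f.continuous.continuousOn
  have hsup : w * ‖f‖ ≤ f (p - q) := by
    rw [← hw' f hf]
    refine csSup_le ((K.nonempty.sub K.nonempty).image _) ?_
    rintro _ ⟨x, hx, rfl⟩
    exact hmax hx
  have h1 : w * ‖f‖ < f (y - q) := by
    rw [map_sub] at hsup ⊢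
    linarith [hfK p hp]
  have h2 : f (y - q) ≤ dist y q * ‖f‖ := by
    rw [dist_eq_norm, mul_comm]
    exact (le_abs_self _).trans (f.le_opNorm _)
  have h3 : w < dist y q :=
    lt_of_mul_lt_mul_right (h1.trans_le h2) (norm_nonneg f)
  refine hdiam.trans_lt (h3.trans_le (Metric.dist_le_diam_of_mem
    (K.isCompact.isBounded.union Bornology.isBounded_singleton) ?_ ?_))
  · exact Set.mem_union_right _ rfl
  · exact Set.mem_union_left _ hq

end ConstantWidth

/-! ### The numerical values of the constants. -/

/-- The number `√(n / (2 (n + 1)))`, the Jung constant of Euclidean `n`-space. -/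
noncomputable def jungNumber (n : ℕ) : ℝ := √((n : ℝ) / (2 * ((n : ℝ) + 1)))

lemma jungNumber_nonneg (n : ℕ) : 0 ≤ jungNumber n := Real.sqrt_nonneg _

lemma jungNumber_sq (n : ℕ) : jungNumber n ^ 2 = (n : ℝ) / (2 * ((n : ℝ) + 1)) :=
  Real.sq_sqrt (by positivity)

lemma jungNumber_lt_one (n : ℕ) : jungNumber n < 1 := by
  refine (sq_lt_one_iff₀ (jungNumber_nonneg n)).1 ?_
  rw [jungNumber_sq, div_lt_one (by positivity)]
  linarith [(Nat.cast_nonneg n : (0 : ℝ) ≤ n)]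

lemma jungNumber_pos {n : ℕ} (hn : 1 ≤ n) : 0 < jungNumber n :=
  Real.sqrt_pos.2 (by have : 0 < (n : ℝ) := by exact_mod_cast hn
                      positivity)

lemma jungNumber_div_one_sub (n : ℕ) : jungNumber n / (1 - jungNumber n) =
    ((n : ℝ) + √(2 * (n : ℝ) * ((n : ℝ) + 1))) / ((n : ℝ) + 2) := by
  have hn : (0 : ℝ) ≤ n := Nat.cast_nonneg n
  have h1 : √(2 * (n : ℝ) * ((n : ℝ) + 1)) = 2 * ((n : ℝ) + 1) * jungNumber n := by
    rw [Real.sqrt_eq_iff_mul_self_eq (by positivity)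
      (mul_nonneg (by positivity) (jungNumber_nonneg n))]
    have := jungNumber_sq n
    field_simp at this
    linear_combination -2 * ((n : ℝ) + 1) * this
  have h2 := jungNumber_lt_one n
  rw [h1, div_eq_div_iff (by linarith) (by positivity)]
  have := jungNumber_sq n
  field_simp at this
  linear_combination this

/-! ### Regular simplices. -/

section Simplex

variable {E : Type*} [NormedAddCommGroup E] [InnerProductSpace ℝ E]

/-- Applied to vectors from a centre to the vertices: dropping the last square bounds the squared
edges by the squared distances to the centre. -/
lemma sum_sum_norm_sub_sq {ι : Type*} [Fintype ι] (u : ι → E) :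
    ∑ i, ∑ j, ‖u i - u j‖ ^ 2 = 2 * Fintype.card ι * ∑ i, ‖u i‖ ^ 2 - 2 * ‖∑ i, u i‖ ^ 2 := by
  have h : ∑ i, ∑ j, inner ℝ (u i) (u j) = ‖∑ i, u i‖ ^ 2 := by
    rw [← real_inner_self_eq_norm_sq, sum_inner]
    simp_rw [inner_sum]
  simp_rw [norm_sub_sq_real, Finset.sum_add_distrib, Finset.sum_sub_distrib, ← Finset.mul_sum, h]
  simp [← Finset.mul_sum]
  ring

/-- A ball containing the vertices of a regular `n`-simplex with edge `D` has radius at least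
`√(n / (2 (n + 1))) D`. -/
lemma jungNumber_mul_le {n : ℕ} {v : Fin (n + 1) → E} {D ρ : ℝ} (hρ : 0 ≤ ρ)
    (hv : ∀ i j, i ≠ j → dist (v i) (v j) = D) {c : E} (hc : ∀ i, dist (v i) c ≤ ρ) :
    jungNumber n * D ≤ ρ := by
  have h1 := sum_sum_norm_sub_sq fun i => v i - c
  have h2 : ∀ i j, ‖v i - c - (v j - c)‖ ^ 2 = if i = j then 0 else D ^ 2 := by
    intro i j
    split_ifs with h
    · simp [h]
    · rw [sub_sub_sub_cancel_right, ← dist_eq_norm, hv i j h]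
  have h3 : ∑ i, ‖v i - c‖ ^ 2 ≤ ∑ _i : Fin (n + 1), ρ ^ 2 := by
    refine Finset.sum_le_sum fun i _ => ?_
    rw [← dist_eq_norm]
    exact pow_le_pow_left₀ dist_nonneg (hc i) 2
  have h4 : ∀ i : Fin (n + 1), ∑ j, (if i = j then 0 else D ^ 2) = n * D ^ 2 := by
    intro i
    have : ∀ j, (if i = j then 0 else D ^ 2) = D ^ 2 - if i = j then D ^ 2 else 0 := by
      intro j; split_ifs <;> simp
    simp_rw [this, Finset.sum_sub_distrib]
    simp
    ring
  simp_rw [h2, h4] at h1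
  simp only [Finset.sum_const, Finset.card_univ, Fintype.card_fin, nsmul_eq_mul, Nat.cast_add,
    Nat.cast_one] at h1 h3
  have h5 : (n : ℝ) * D ^ 2 ≤ 2 * (n + 1) * ρ ^ 2 := by
    refine le_of_mul_le_mul_left ?_ (show (0 : ℝ) < n + 1 by positivity)
    have : 2 * ((n : ℝ) + 1) * ∑ i, ‖v i - c‖ ^ 2 ≤ 2 * ((n : ℝ) + 1) * ((n + 1) * ρ ^ 2) := by
      gcongr
    linarith [sq_nonneg ‖∑ i, (v i - c)‖]
  refine le_of_sq_le_sq ?_ hρ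
  rw [mul_pow, jungNumber_sq, div_mul_eq_mul_div, div_le_iff₀ (by positivity)]
  linarith

/-- A lower bound for the dilations showing the asymmetry of a set of diameter `D` that contains
the vertices of a regular simplex with edge `D`. -/
lemma jungNumber_div_le_of_neg_subset {n : ℕ} {v : Fin (n + 1) → E} {K : Set E}
    (hb : Bornology.IsBounded K) (hD : 0 < Metric.diam K)
    (hv : ∀ i j, i ≠ j → dist (v i) (v j) = Metric.diam K) (hvK : ∀ i, v i ∈ K) {a : E} {ρ : ℝ}
    (hρ : 0 < ρ) (h : -K ⊆ a +ᵥ ρ • K) : jungNumber n / (1 - jungNumber n) ≤ ρ := by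
  -- The centre is the fixed point of the homothety x ↦ -a - ρx, which sends some k in K to `v i`;
  -- so `v i` is at distance ρ/(1 + ρ) · ‖k - v i‖ from it.
  have key : ∀ i, dist (v i) (-(1 / (1 + ρ)) • a) ≤ ρ * Metric.diam K / (1 + ρ) := by
    intro i
    obtain ⟨_, ⟨k, hk, rfl⟩, hk'⟩ := h (Set.neg_mem_neg.2 (hvK i))
    have hd := Metric.dist_le_diam_of_mem hb hk (hvK i)
    simp only [vadd_eq_add] at hk'
    have ha : a = -v i - ρ • k := eq_sub_of_add_eq hk'
    have : v i - -(1 / (1 + ρ)) • a = -((ρ / (1 + ρ)) • (k - v i)) := by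
      have : 1 + ρ ≠ 0 := by positivity
      rw [ha]
      match_scalars <;> field_simp
      ring
    rw [dist_eq_norm, this, norm_neg, norm_smul, Real.norm_of_nonneg (by positivity),
      ← dist_eq_norm, div_mul_eq_mul_div]
    gcongr
  have h1 := jungNumber_mul_le (by positivity) hv key
  rw [le_div_iff₀ (by positivity)] at h1
  have h2 : jungNumber n * (1 + ρ) ≤ ρ := le_of_mul_le_mul_right (by linarith) hD
  rw [div_le_iff₀ (by linarith [jungNumber_lt_one n])]
  linarith

/-- For an affine relation w, evaluating ∑ j, w j ‖v i - v j‖² in two ways shows that D² w i does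
not depend on i; as the weights add up to 0, they vanish. -/
lemma affineIndependent_of_dist_eq {ι : Type*} {v : ι → E} {D : ℝ} (hD : 0 < D)
    (hv : ∀ i j, i ≠ j → dist (v i) (v j) = D) : AffineIndependent ℝ v := by
  classical
  rw [affineIndependent_iff]
  intro s w hw0 hw1
  have h1 : ∀ i ∈ s, D ^ 2 * w i = - ∑ j ∈ s, w j * ‖v j‖ ^ 2 := by
    intro i hi
    have e1 : ∑ j ∈ s, w j * ‖v i - v j‖ ^ 2 = ∑ j ∈ s, w j * ‖v j‖ ^ 2 := by
      have : ∑ j ∈ s, w j * inner ℝ (v i) (v j) = 0 := by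
        simp_rw [← inner_smul_right]
        rw [← inner_sum, hw1, inner_zero_right]
      simp_rw [norm_sub_sq_real, mul_add, mul_sub, Finset.sum_add_distrib, Finset.sum_sub_distrib,
        ← Finset.sum_mul, hw0]
      simp_rw [mul_left_comm _ (2 : ℝ), ← Finset.mul_sum, this]
      ring
    have e2 : ∑ j ∈ s, w j * ‖v i - v j‖ ^ 2 = - (D ^ 2 * w i) := by
      have : ∀ j ∈ s, w j * ‖v i - v j‖ ^ 2 = w j * D ^ 2 - if i = j then w j * D ^ 2 else 0 := by
        intro j _
        split_ifs with h
        · simp [h]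
        · rw [← dist_eq_norm, hv i j h, sub_zero]
      rw [Finset.sum_congr rfl this, Finset.sum_sub_distrib, ← Finset.sum_mul, hw0,
        Finset.sum_ite_eq, if_pos hi]
      ring
    linarith
  set C := ∑ j ∈ s, w j * ‖v j‖ ^ 2
  intro i hi
  have h2 : ∑ i ∈ s, D ^ 2 * w i = ∑ i ∈ s, -C := Finset.sum_congr rfl h1
  rw [← Finset.mul_sum, hw0, mul_zero, Finset.sum_const, nsmul_eq_mul, eq_comm, mul_eq_zero] at h2
  have hC : C = 0 := by
    rcases h2 with h2 | h2
    · simp at h2; simp [h2] at hi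
    · linarith
  have := h1 i hi
  rw [hC, neg_zero, mul_eq_zero] at this
  exact this.resolve_left (by positivity)

lemma exists_dist_eq (n : ℕ) : ∃ v : Fin (n + 1) → EuclideanSpace ℝ (Fin n),
    ∀ i j, i ≠ j → dist (v i) (v j) = √2 := by
  rcases Nat.eq_zero_or_pos n with rfl | hn
  · exact ⟨fun _ => 0, fun i j h => absurd (Subsingleton.elim (α := Fin 1) i j) h⟩
  have hn' : (0 : ℝ) < n := by exact_mod_cast hn
  -- The vertices are the standard basis and (a, …, a), where a solves n a² - 2a + 1 = 2.
  set a : ℝ := (1 + √(n + 1)) / n with ha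
  have hs : √((n : ℝ) + 1) ^ 2 = n + 1 := Real.sq_sqrt (by positivity)
  have ha' : n * a ^ 2 - 2 * a + 1 = 2 := by
    rw [ha]; field_simp; linear_combination hs
  set p : EuclideanSpace ℝ (Fin n) := WithLp.toLp 2 fun _ => a with hp
  have h1 : ∀ i, dist p (EuclideanSpace.single i 1) = √2 := by
    intro i
    rw [EuclideanSpace.dist_eq]
    congr 1
    have : ∀ k, dist (p k) ((EuclideanSpace.single i (1 : ℝ) : EuclideanSpace ℝ (Fin n)) k) ^ 2 =
        a ^ 2 + if k = i then 1 - 2 * a else 0 := by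
      intro k
      rw [Real.dist_eq, sq_abs]
      simp only [hp, PiLp.single_apply]
      split_ifs <;> ring
    simp_rw [this, Finset.sum_add_distrib]
    simp
    linarith
  have h2 : ∀ i j : Fin n, i ≠ j → dist (EuclideanSpace.single i (1 : ℝ) : EuclideanSpace ℝ (Fin n))
      (EuclideanSpace.single j 1) = √2 := by
    intro i j hij
    rw [EuclideanSpace.dist_eq]
    congr 1
    have : ∀ k, dist ((EuclideanSpace.single i (1 : ℝ) : EuclideanSpace ℝ (Fin n)) k)
        ((EuclideanSpace.single j (1 : ℝ) : EuclideanSpace ℝ (Fin n)) k) ^ 2 =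
        (if k = i then 1 else 0) + if k = j then 1 else 0 := by
      intro k
      rw [Real.dist_eq, sq_abs]
      simp only [PiLp.single_apply]
      split_ifs with h h' h'
      · exact absurd (h.symm.trans h') hij
      all_goals norm_num
    simp_rw [this, Finset.sum_add_distrib]
    simp
    norm_num
  refine ⟨Fin.cons p fun i => EuclideanSpace.single i 1, fun i j => ?_⟩
  refine Fin.cases ?_ (fun i => ?_) i <;> refine Fin.cases ?_ (fun j => ?_) j <;> intro hij
  · exact absurd rfl hij
  · simpa using h1 j
  · simpa [dist_comm] using h1 i
  · simpa using h2 i j (by simpa using hij)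

/-- Equilateral simplices of Euclidean space are regular. -/
lemma regular_of_dist_eq {n : ℕ} (S : Affine.Simplex ℝ E n) {D : ℝ}
    (hS : ∀ i j, i ≠ j → dist (S.points i) (S.points j) = D) : S.Regular := by
  intro σ
  induction σ using Equiv.Perm.swap_induction_on with
  | one => exact ⟨IsometryEquiv.refl E, rfl⟩
  | swap_mul f a b hab ih =>
    obtain ⟨x, hx⟩ := ih
    set p := S.points with hp
    -- Transpositions suffice: the reflection in the perpendicular bisector of an edge swaps its
    -- ends and fixes the other vertices, which are equidistant from them.
    set m : E := midpoint ℝ (p a) (p b) with hm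
    set y : E ≃ᵢ E := ((IsometryEquiv.subRight m).trans
      (((ℝ ∙ (p a - p b))ᗮ).reflection.toIsometryEquiv)).trans (IsometryEquiv.addRight m) with hy
    have hyz : ∀ z, y z = ((ℝ ∙ (p a - p b))ᗮ).reflection (z - m) + m := fun z => rfl
    have ham : p a - m = (2⁻¹ : ℝ) • (p a - p b) := by
      rw [hm, midpoint_eq_smul_add, invOf_eq_inv]; module
    have hbm : p b - m = -((2⁻¹ : ℝ) • (p a - p b)) := by
      rw [hm, midpoint_eq_smul_add, invOf_eq_inv]; module
    have hrefl : ((ℝ ∙ (p a - p b))ᗮ).reflection (p a - p b) = -(p a - p b) :=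
      Submodule.reflection_orthogonalComplement_singleton_eq_neg _
    have hya : y (p a) = p b := by
      rw [hyz, ham, map_smul, hrefl, smul_neg, ← hbm, sub_add_cancel]
    have hyb : y (p b) = p a := by
      rw [hyz, hbm, map_neg, map_smul, hrefl, smul_neg, neg_neg, ← ham, sub_add_cancel]
    have hyk : ∀ k, k ≠ a → k ≠ b → y (p k) = p k := by
      intro k hka hkb
      have h1 : p k - m ∈ (ℝ ∙ (p a - p b))ᗮ := by
        rw [Submodule.mem_orthogonal_singleton_iff_inner_right]
        have e1 := hS k a hka
        have e2 := hS k b hkb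
        rw [dist_eq_norm] at e1 e2
        have e3 : p k - p a = (p k - m) - (2⁻¹ : ℝ) • (p a - p b) := by rw [← ham]; abel
        have e4 : p k - p b = (p k - m) + (2⁻¹ : ℝ) • (p a - p b) := by
          rw [← neg_neg ((2⁻¹ : ℝ) • (p a - p b)), ← hbm]; abel
        have e5 := norm_sub_sq_real (p k - m) ((2⁻¹ : ℝ) • (p a - p b))
        have e6 := norm_add_sq_real (p k - m) ((2⁻¹ : ℝ) • (p a - p b))
        rw [← e3, e1] at e5
        rw [← e4, e2, inner_smul_right] at e6
        rw [inner_smul_right] at e5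
        rw [real_inner_comm]
        linarith
      rw [hyz, Submodule.reflection_mem_subspace_eq_self h1, sub_add_cancel]
    refine ⟨x.trans y, ?_⟩
    have hswap : ∀ k, p (Equiv.swap a b k) = y (p k) := by
      intro k
      by_cases hka : k = a
      · rw [hka, Equiv.swap_apply_left, hya]
      by_cases hkb : k = b
      · rw [hkb, Equiv.swap_apply_right, hyb]
      rw [Equiv.swap_apply_of_ne_of_ne hka hkb, hyk k hka hkb]
    funext i
    change p (Equiv.swap a b (f i)) = y (x (p i))
    rw [hswap]
    exact congrArg y (congrFun hx i)

end Simplex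

/-! ### Jung's theorem and its equality case. -/

section Jung

variable {E : Type*} [NormedAddCommGroup E] [InnerProductSpace ℝ E] [FiniteDimensional ℝ E]

/-- In finite dimension, convex hulls of compact sets are compact. -/
lemma isCompact_convexHull_of_isCompact {C : Set E} (hC : IsCompact C) :
    IsCompact (convexHull ℝ C) := by
  -- Carathéodory: at most `finrank + 1` points are needed, so the hull is a finite union of
  -- continuous images of compact sets.
  have h : convexHull ℝ C = ⋃ m ∈ Finset.range (Module.finrank ℝ E + 2),
      (fun p : (Fin m → ℝ) × (Fin m → E) => ∑ i, p.1 i • p.2 i) ''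
        (stdSimplex ℝ (Fin m) ×ˢ Set.univ.pi fun _ => C) := by
    apply Set.Subset.antisymm
    · intro x hx
      obtain ⟨ι, _, z, w, hzC, hz, hw0, hw1, rfl⟩ := eq_pos_convex_span_of_mem_convexHull hx
      have hcard : Fintype.card ι ≤ Module.finrank ℝ E + 1 := hz.card_le_finrank_succ.trans
        (Nat.add_le_add_right (Submodule.finrank_le _) 1)
      let e := (Fintype.equivFin ι).symm
      refine Set.mem_biUnion (Finset.mem_coe.2 (Finset.mem_range.2 (Nat.lt_succ_of_le hcard)))
        ⟨(w ∘ e, z ∘ e), ⟨⟨fun i => (hw0 _).le, ?_⟩, fun i _ => hzC ⟨_, rfl⟩⟩, ?_⟩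
      · exact (e.sum_comp w).trans hw1
      · exact e.sum_comp fun i => w i • z i
    · refine Set.iUnion₂_subset fun m _ => ?_
      rintro _ ⟨⟨w, z⟩, ⟨⟨hw0, hw1⟩, hz⟩, rfl⟩
      exact (convex_convexHull ℝ C).sum_mem (fun i _ => hw0 i) hw1
        fun i _ => subset_convexHull ℝ C (hz i trivial)
  rw [h]
  refine (Finset.range _).isCompact_biUnion fun m _ => ?_
  refine ((isCompact_stdSimplex ℝ (Fin m)).prod (isCompact_univ_pi fun _ => hC)).image ?_
  fun_prop

/-- A circumcenter lies in the convex hull of the contact points of the circumsphere. -/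
lemma IsCircumcenter.mem_convexHull {K : Set E} {c : E} (hc : IsCircumcenter K c)
    (hK : IsCompact K) (hR : 0 < outerRadius K) :
    c ∈ convexHull ℝ (K ∩ Metric.sphere c (outerRadius K)) := by
  set R := outerRadius K with hRdef
  by_contra hcon
  have hC : IsCompact (K ∩ Metric.sphere c R) := hK.inter_right Metric.isClosed_sphere
  -- If c could be separated from the contact points, moving it slightly towards them would give a
  -- smaller ball containing K.
  obtain ⟨f, u, hfc, hfb⟩ := geometric_hahn_banach_point_closed (convex_convexHull ℝ _)
    (isCompact_convexHull_of_isCompact hC).isClosed hcon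
  set v : E := (InnerProductSpace.toDual ℝ E).symm f with hv
  have hfv : ∀ x, f x = inner ℝ v x := fun x => by
    rw [hv, InnerProductSpace.toDual_symm_apply]
  set δ := u - f c with hδ
  have hδ0 : 0 < δ := sub_pos.2 hfc
  have hCδ : ∀ x ∈ K, dist x c = R → δ < inner ℝ v (x - c) := by
    intro x hx hxc
    rw [inner_sub_right, ← hfv, ← hfv]
    have := hfb x (subset_convexHull ℝ _ ⟨hx, hxc⟩)
    linarith
  obtain ⟨M, hM0, hMR, hM⟩ : ∃ M, 0 ≤ M ∧ M < R ∧
      ∀ x ∈ K, inner ℝ v (x - c) ≤ δ → dist x c ≤ M := by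
    have hK' : IsCompact (K ∩ {x | inner ℝ v (x - c) ≤ δ}) :=
      hK.inter_right (isClosed_le (by fun_prop) (by fun_prop))
    rcases (K ∩ {x | inner ℝ v (x - c) ≤ δ}).eq_empty_or_nonempty with h | h
    · exact ⟨0, le_rfl, hR, fun x hx hx' => (Set.eq_empty_iff_forall_notMem.1 h x ⟨hx, hx'⟩).elim⟩
    · obtain ⟨x₀, hx₀, hmax⟩ := hK'.exists_isMaxOn h
        (show ContinuousOn (fun x => dist x c) _ by fun_prop)
      refine ⟨dist x₀ c, dist_nonneg, (hc hx₀.1).lt_of_ne fun he => ?_,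
        fun x hx hx' => hmax ⟨hx, hx'⟩⟩
      exact (hCδ x₀ hx₀.1 he).not_ge hx₀.2
  -- The first bound keeps points within M of c at distance at most (R + M)/2 from the new centre.
  -- For the others the squared distance changes by -2ε⟨v, x - c⟩ + ε²‖v‖² ≤ -εδ, by the second
  -- bound.
  obtain ⟨ε, hε0, hε1, hε2⟩ : ∃ ε, 0 < ε ∧ ε * ‖v‖ ≤ (R - M) / 2 ∧ ε * ‖v‖ ^ 2 ≤ δ := by
    have h1 : 0 < (R - M) / 2 / (‖v‖ + 1) := div_pos (by linarith) (by positivity)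
    have h2 : 0 < δ / (‖v‖ ^ 2 + 1) := by positivity
    refine ⟨min _ _, lt_min h1 h2, ?_, ?_⟩
    · calc _ ≤ (R - M) / 2 / (‖v‖ + 1) * (‖v‖ + 1) := by
            gcongr
            · exact min_le_left _ _
            · linarith
        _ = (R - M) / 2 := div_mul_cancel₀ _ (by positivity)
    · calc _ ≤ δ / (‖v‖ ^ 2 + 1) * (‖v‖ ^ 2 + 1) := by
            gcongr
            · exact min_le_right _ _
            · linarith
        _ = δ := div_mul_cancel₀ _ (by positivity)
  set ρ := max ((R + M) / 2) √(R ^ 2 - ε * δ) with hρ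
  have hρR : ρ < R := by
    refine max_lt (by linarith) ?_
    rw [Real.sqrt_lt' hR]
    linarith [mul_pos hε0 hδ0]
  have hsub : K ⊆ Metric.closedBall (c + ε • v) ρ := by
    intro x hx
    rw [mem_closedBall_iff_norm, ← sub_sub]
    by_cases hxδ : inner ℝ v (x - c) ≤ δ
    · refine le_trans ?_ (le_max_left _ _)
      have h1 := hM x hx hxδ
      rw [dist_eq_norm] at h1
      have h2 := norm_sub_le (x - c) (ε • v)
      rw [norm_smul, Real.norm_of_nonneg hε0.le] at h2
      linarith
    · refine le_trans (Real.le_sqrt_of_sq_le ?_) (le_max_right _ _)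
      have h1 : ‖x - c‖ ≤ R := mem_closedBall_iff_norm.1 (hc hx)
      have h2 := norm_sub_sq_real (x - c) (ε • v)
      rw [inner_smul_right, real_inner_comm, norm_smul, Real.norm_of_nonneg hε0.le] at h2
      have h3 : ‖x - c‖ ^ 2 ≤ R ^ 2 := pow_le_pow_left₀ (norm_nonneg _) h1 2
      have h4 : ε * δ ≤ ε * inner ℝ v (x - c) := by
        gcongr
        exact (not_le.1 hxδ).le
      have h5 : ε * (ε * ‖v‖ ^ 2) ≤ ε * δ := by gcongr
      rw [h2]
      linarith [show (ε * ‖v‖) ^ 2 = ε * (ε * ‖v‖ ^ 2) by ring]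
  have h0 : 0 ≤ ρ := le_max_of_le_left (by linarith)
  exact (outerRadius_le h0 hsub).not_gt hρR

omit [FiniteDimensional ℝ E] in
/-- The defects of the edges of a simplex of contact points, weighted by the barycentric
coordinates of the circumcenter, add up to `(m - 1) D² - 2 m R²`. -/
lemma sum_sum_mul_sq_sub_dist_sq {ι : Type*} [Fintype ι] [DecidableEq ι] {z : ι → E} {w : ι → ℝ}
    {c : E} {R D : ℝ} (hw : ∑ i, w i = 1) (hc : ∑ i, w i • z i = c) (hz : ∀ i, dist (z i) c = R) :
    ∑ j, ∑ i, w i * ((if i = j then 0 else D ^ 2) - dist (z i) (z j) ^ 2) =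
      (Fintype.card ι - 1) * D ^ 2 - 2 * Fintype.card ι * R ^ 2 := by
  have h0 : ∑ i, w i • (z i - c) = 0 := by
    simp_rw [smul_sub, Finset.sum_sub_distrib, ← Finset.sum_smul, hw, hc, one_smul, sub_self]
  -- Expanding about c, the cross terms cancel because c is the weighted mean of the `z i`.
  have h1 : ∀ j, ∑ i, w i * dist (z i) (z j) ^ 2 = 2 * R ^ 2 := by
    intro j
    have e : ∀ i, w i * dist (z i) (z j) ^ 2 =
        w i * (2 * R ^ 2) - 2 * inner ℝ (w i • (z i - c)) (z j - c) := by
      intro i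
      rw [dist_eq_norm, ← sub_sub_sub_cancel_right _ _ c, norm_sub_sq_real, ← dist_eq_norm,
        ← dist_eq_norm, hz, hz, inner_smul_left]
      simp
      ring
    simp_rw [e, Finset.sum_sub_distrib, ← Finset.sum_mul, ← Finset.mul_sum, ← sum_inner, h0, hw]
    simp
  have h2 : ∀ j, ∑ i, w i * (if i = j then 0 else D ^ 2) = D ^ 2 - w j * D ^ 2 := by
    intro j
    have e : ∀ i, w i * (if i = j then 0 else D ^ 2) =
        w i * D ^ 2 - if i = j then w i * D ^ 2 else 0 := by
      intro i; split_ifs <;> simp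
    simp_rw [e, Finset.sum_sub_distrib, ← Finset.sum_mul, hw]
    simp
  simp_rw [mul_sub, Finset.sum_sub_distrib, h1, h2, Finset.sum_sub_distrib, ← Finset.sum_mul, hw]
  simp
  ring

/-- Jung's theorem, together with its equality case. -/
lemma jung {n : ℕ} (hn : Module.finrank ℝ E = n) {K : Set E} (hK : IsCompact K)
    (hD : 0 < Metric.diam K) :
    outerRadius K ≤ jungNumber n * Metric.diam K ∧
    (outerRadius K = jungNumber n * Metric.diam K → ∃ z : Fin (n + 1) → E,
      (∀ i, z i ∈ K) ∧ ∀ i j, i ≠ j → dist (z i) (z j) = Metric.diam K) := by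
  classical
  have hne : K.Nonempty := by
    by_contra h
    rw [Set.not_nonempty_iff_eq_empty] at h
    simp [h] at hD
  have : ProperSpace E := FiniteDimensional.proper ℝ E
  have hR : 0 < outerRadius K := outerRadius_pos hD
  obtain ⟨c, hc⟩ := exists_isCircumcenter hK.isBounded hne
  obtain ⟨ι, _, z, w, hzK, hz, hw0, hw1, hwc⟩ :=
    eq_pos_convex_span_of_mem_convexHull (hc.mem_convexHull hK hR)
  have hzK' : ∀ i, z i ∈ K := fun i => (hzK ⟨i, rfl⟩).1
  have hsum := sum_sum_mul_sq_sub_dist_sq (D := Metric.diam K) hw1 hwc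
    fun i => (hzK ⟨i, rfl⟩).2
  have hnonneg : ∀ i j, 0 ≤ w i *
      ((if i = j then 0 else Metric.diam K ^ 2) - dist (z i) (z j) ^ 2) := by
    intro i j
    refine mul_nonneg (hw0 i).le (sub_nonneg.2 ?_)
    split_ifs with h
    · simp [h]
    · exact pow_le_pow_left₀ dist_nonneg
        (Metric.dist_le_diam_of_mem hK.isBounded (hzK' i) (hzK' j)) 2
  have hcard : Fintype.card ι ≤ n + 1 := hn ▸ hz.card_le_finrank_succ.trans
    (Nat.add_le_add_right (Submodule.finrank_le _) 1)
  have hcard0 : 0 < Fintype.card ι := by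
    rw [Fintype.card_pos_iff]
    by_contra h
    rw [not_nonempty_iff] at h
    simp at hw1
  have hm0 : (0 : ℝ) < Fintype.card ι := by exact_mod_cast hcard0
  have hm : (Fintype.card ι : ℝ) ≤ n + 1 := by exact_mod_cast hcard
  have hn0 : (0 : ℝ) ≤ n := Nat.cast_nonneg n
  set m : ℝ := (Fintype.card ι : ℝ) with hmdef
  -- The defects are nonnegative. Since (m - 1)/(2m) increases with m ≤ n + 1, this yields Jung's
  -- bound.
  have h1 : 2 * m * outerRadius K ^ 2 ≤ (m - 1) * Metric.diam K ^ 2 := by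
    have := Finset.sum_nonneg fun j (_ : j ∈ Finset.univ) => Finset.sum_nonneg
      fun i (_ : i ∈ Finset.univ) => hnonneg i j
    linarith
  refine ⟨?_, fun heq => ?_⟩
  · refine le_of_sq_le_sq ?_ (mul_nonneg (jungNumber_nonneg n) hD.le)
    rw [mul_pow, jungNumber_sq]
    have h2 : outerRadius K ^ 2 ≤ (m - 1) / (2 * m) * Metric.diam K ^ 2 := by
      rw [div_mul_eq_mul_div, le_div_iff₀ (by positivity)]
      linarith
    refine h2.trans (mul_le_mul_of_nonneg_right ?_ (sq_nonneg _))
    rw [div_le_div_iff₀ (by positivity) (by positivity)]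
    linarith
  · have h2 : 2 * (n + 1) * outerRadius K ^ 2 = n * Metric.diam K ^ 2 := by
      rw [heq, mul_pow, jungNumber_sq]; field_simp
    have hD2 : 0 < Metric.diam K ^ 2 := by positivity
    -- Equality forces the full number of contact points; then the defects add up to 0, and
    -- positivity of the weights makes every edge equal to the diameter.
    have hmn : m = n + 1 := by
      refine hm.antisymm ?_
      have h3 := mul_le_mul_of_nonneg_left h1 (show 0 ≤ (n : ℝ) + 1 by positivity)
      have h4 : ((n : ℝ) + 1) * (2 * m * outerRadius K ^ 2) = m * (n * Metric.diam K ^ 2) := by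
        rw [← h2]; ring
      rw [h4] at h3
      refine le_of_mul_le_mul_right ?_ hD2
      linarith
    have hcard' : Fintype.card ι = n + 1 := by
      rw [hmdef] at hmn; exact_mod_cast hmn
    have h0 : ∑ j, ∑ i, w i *
        ((if i = j then 0 else Metric.diam K ^ 2) - dist (z i) (z j) ^ 2) = 0 := by
      rw [hsum, hmn]; linarith
    have hdist : ∀ i j, i ≠ j → dist (z i) (z j) = Metric.diam K := by
      intro i j hij
      have e1 := (Finset.sum_eq_zero_iff_of_nonneg fun j _ => Finset.sum_nonneg
        fun i _ => hnonneg i j).1 h0 j (Finset.mem_univ j)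
      have e2 := (Finset.sum_eq_zero_iff_of_nonneg fun i _ => hnonneg i j).1 e1 i
        (Finset.mem_univ i)
      rw [if_neg hij, mul_eq_zero, sub_eq_zero] at e2
      have e3 := e2.resolve_left (hw0 i).ne'
      exact ((sq_eq_sq₀ hD.le dist_nonneg).1 e3).symm
    let e := (Fintype.equivFinOfCardEq hcard').symm
    exact ⟨z ∘ e, fun i => hzK' _, fun i j hij => hdist _ _ (e.injective.ne hij)⟩

end Jung

/-! ### Values of the constants and the extremal bodies in Euclidean space. -/

section Euclidean

variable {n : ℕ}

local notation "𝔼" => EuclideanSpace ℝ (Fin n)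

lemma nontrivial_euclideanSpace (hn : 1 ≤ n) : Nontrivial 𝔼 :=
  Module.nontrivial_of_finrank_pos (R := ℝ) (by rw [finrank_euclideanSpace_fin]; exact hn)

lemma diam_convexHull_range {v : Fin (n + 1) → 𝔼} {D : ℝ} (hn : 1 ≤ n)
    (hv : ∀ i j, i ≠ j → dist (v i) (v j) = D) :
    Metric.diam (convexHull ℝ (Set.range v)) = D := by
  have h01 : (0 : Fin (n + 1)) ≠ Fin.last n := by
    rw [Ne, Fin.ext_iff]; simp; omega
  rw [convexHull_diam]
  refine le_antisymm (Metric.diam_le_of_forall_dist_le (hv _ _ h01 ▸ dist_nonneg) ?_) ?_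
  · rintro _ ⟨i, rfl⟩ _ ⟨j, rfl⟩
    by_cases h : i = j
    · rw [h, dist_self, ← hv _ _ h01]; exact dist_nonneg
    · exact (hv i j h).le
  · rw [← hv _ _ h01]
    exact Metric.dist_le_diam_of_mem (Set.finite_range v).isBounded ⟨_, rfl⟩ ⟨_, rfl⟩

/-- A set of diameter `D` that contains a regular simplex with edge `D` is extremal in Jung's
theorem. -/
lemma outerRadius_eq_jungNumber_mul {K : Set 𝔼} (hK : IsCompact K) (hD : 0 < Metric.diam K)
    {v : Fin (n + 1) → 𝔼} (hv : ∀ i j, i ≠ j → dist (v i) (v j) = Metric.diam K)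
    (hvK : ∀ i, v i ∈ K) : outerRadius K = jungNumber n * Metric.diam K := by
  refine (jung (by simp) hK hD).1.antisymm ?_
  obtain ⟨c, hc⟩ := exists_isCircumcenter hK.isBounded ⟨_, hvK 0⟩
  exact jungNumber_mul_le (outerRadius_nonneg K) hv fun i => hc (hvK i)

/-- The vertices and the edge length of a regular simplex. -/
lemma IsRegularSimplex.exists_vertices (hn : 1 ≤ n) {T : Set 𝔼} (hT : IsRegularSimplex T) :
    0 < Metric.diam T ∧ ∃ v : Fin (n + 1) → 𝔼,
      (∀ i j, i ≠ j → dist (v i) (v j) = Metric.diam T) ∧ T = convexHull ℝ (Set.range v) := by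
  obtain ⟨S, hS, rfl⟩ := hT
  obtain ⟨D, hD⟩ := hS.equilateral
  have hdiam := diam_convexHull_range hn hD
  refine ⟨?_, S.points, ?_, rfl⟩
  · have h01 : (0 : Fin (n + 1)) ≠ Fin.last n := by
      rw [Ne, Fin.ext_iff]; simp; omega
    rw [hdiam, ← hD _ _ h01]
    exact dist_pos.2 (S.independent.injective.ne h01)
  · rw [hdiam]; exact hD

lemma isRegularSimplex_of_dist_eq {v : Fin (n + 1) → 𝔼} {D : ℝ} (hD : 0 < D)
    (hv : ∀ i j, i ≠ j → dist (v i) (v j) = D) :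
    IsRegularSimplex (convexHull ℝ (Set.range v)) :=
  ⟨⟨v, affineIndependent_of_dist_eq hD hv⟩, regular_of_dist_eq _ hv, rfl⟩

lemma exists_isRegularSimplex (n : ℕ) :
    ∃ T : ConvexBody (EuclideanSpace ℝ (Fin n)), IsRegularSimplex (T : Set (EuclideanSpace ℝ (Fin n))) := by
  obtain ⟨v, hv⟩ := exists_dist_eq n
  exact ⟨⟨convexHull ℝ (Set.range v), convex_convexHull ℝ _,
    (Set.finite_range v).isCompact_convexHull ℝ, (Set.range_nonempty v).convexHull⟩,
    isRegularSimplex_of_dist_eq (by positivity) hv⟩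

lemma isGreatest_jungRatios (hn : 1 ≤ n) : IsGreatest (jungRatios 𝔼) (jungNumber n) := by
  refine ⟨?_, ?_⟩
  · obtain ⟨T, hT⟩ := exists_isRegularSimplex n
    obtain ⟨hD, v, hv, hTv⟩ := hT.exists_vertices hn
    have hvT : ∀ i, v i ∈ (T : Set 𝔼) := fun i => hTv ▸ subset_convexHull ℝ _ ⟨i, rfl⟩
    refine ⟨T, hD, ?_⟩
    rw [jungRatio, outerRadius_eq_jungNumber_mul T.isCompact hD hv hvT,
      mul_div_cancel_right₀ _ hD.ne']
  · rintro _ ⟨K, hD, rfl⟩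
    rw [jungRatio, div_le_iff₀ hD]
    exact (jung (by simp) K.isCompact hD).1

lemma jungConstant_eq (hn : 1 ≤ n) : jungConstant 𝔼 = jungNumber n :=
  (isGreatest_jungRatios hn).csSup_eq

/-- If circumradius and inradius of `K` add up to the diameter then `s(K) ≤ j / (1 - j)`, with
equality only if `K` contains a regular simplex with edge `D(K)`. -/
lemma asymmetry_le_of_radii (hn : 1 ≤ n) (K : ConvexBody 𝔼)
    (h : outerRadius (K : Set 𝔼) + innerRadius (K : Set 𝔼) = Metric.diam (K : Set 𝔼)) :
    asymmetry (K : Set 𝔼) ≤ jungNumber n / (1 - jungNumber n) ∧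
    (asymmetry (K : Set 𝔼) = jungNumber n / (1 - jungNumber n) → 0 < Metric.diam (K : Set 𝔼) ∧
      ∃ v : Fin (n + 1) → 𝔼, (∀ i, v i ∈ (K : Set 𝔼)) ∧
        ∀ i j, i ≠ j → dist (v i) (v j) = Metric.diam (K : Set 𝔼)) := by
  have := nontrivial_euclideanSpace hn
  have hj1 := jungNumber_lt_one n
  have hj0 := jungNumber_pos hn
  have hs0 : 0 < jungNumber n / (1 - jungNumber n) := div_pos hj0 (by linarith)
  rcases (Metric.diam_nonneg (s := (K : Set 𝔼))).eq_or_lt with hD | hD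
  -- A single point admits every ρ > 0, so its asymmetry is 0 and it is never extremal.
  · have hs : asymmetry (K : Set 𝔼) ≤ 0 := by
      obtain ⟨x, hx⟩ := K.nonempty
      have hKx : (K : Set 𝔼) = {x} := by
        refine Set.eq_singleton_iff_unique_mem.2 ⟨hx, fun y hy => dist_le_zero.1 ?_⟩
        exact hD ▸ Metric.dist_le_diam_of_mem K.isCompact.isBounded hy hx
      refine le_of_forall_pos_le_add fun ε hε => ?_
      rw [zero_add]
      refine asymmetry_le (a := -x - ε • x) hε ?_
      rw [hKx]
      simp
    exact ⟨hs.trans hs0.le, fun he => absurd (he ▸ hs) hs0.not_ge⟩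
  obtain ⟨hJ, hJeq⟩ := jung (E := 𝔼) (n := n) (by simp) K.isCompact hD
  have hR := outerRadius_pos hD
  have hr : 0 < innerRadius (K : Set 𝔼) := by
    have := mul_lt_mul_of_pos_right hj1 hD
    linarith
  obtain ⟨c, h1, h2⟩ := exists_concentric_balls K.isCompact K.nonempty h
  obtain ⟨a, ha⟩ := exists_neg_subset_vadd_smul hr hR h1 h2
  have hs := asymmetry_le (div_pos hR hr) ha
  have hle : outerRadius (K : Set 𝔼) / innerRadius (K : Set 𝔼) ≤
      jungNumber n / (1 - jungNumber n) := by
    rw [div_le_div_iff₀ hr (by linarith)]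
    have : innerRadius (K : Set 𝔼) = Metric.diam (K : Set 𝔼) - outerRadius (K : Set 𝔼) := by
      linarith
    rw [this]
    linarith
  refine ⟨hs.trans hle, fun he => ⟨hD, hJeq (hJ.antisymm ?_)⟩⟩
  rw [he, div_le_div_iff₀ (by linarith) hr] at hs
  have : innerRadius (K : Set 𝔼) = Metric.diam (K : Set 𝔼) - outerRadius (K : Set 𝔼) := by
    linarith
  rw [this] at hs
  linarith

/-- The asymmetry of bodies that contain a regular simplex of the same diameter. -/
lemma asymmetry_eq_of_radii (hn : 1 ≤ n) (K : ConvexBody 𝔼)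
    (h : outerRadius (K : Set 𝔼) + innerRadius (K : Set 𝔼) = Metric.diam (K : Set 𝔼))
    (hD : 0 < Metric.diam (K : Set 𝔼)) {v : Fin (n + 1) → 𝔼} (hvK : ∀ i, v i ∈ (K : Set 𝔼))
    (hv : ∀ i j, i ≠ j → dist (v i) (v j) = Metric.diam (K : Set 𝔼)) :
    asymmetry (K : Set 𝔼) = jungNumber n / (1 - jungNumber n) := by
  have := nontrivial_euclideanSpace hn
  refine (asymmetry_le_of_radii hn K h).1.antisymm ?_
  have hR := outerRadius_pos hD
  have hr : 0 < innerRadius (K : Set 𝔼) := by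
    have h1 := mul_lt_mul_of_pos_right (jungNumber_lt_one n) hD
    have h2 := (jung (E := 𝔼) (n := n) (by simp) K.isCompact hD).1
    linarith
  obtain ⟨c, h1, h2⟩ := exists_concentric_balls K.isCompact K.nonempty h
  refine le_csInf ⟨_, div_pos hR hr, exists_neg_subset_vadd_smul hr hR h1 h2⟩ ?_
  rintro ρ ⟨hρ, a, ha⟩
  exact jungNumber_div_le_of_neg_subset K.isCompact.isBounded hD hv hvK hρ ha

lemma asymmetry_eq_of_isCompletion (hn : 1 ≤ n) {T : Set 𝔼} (hT : IsRegularSimplex T)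
    {C : ConvexBody 𝔼} (hC : IsCompletion T C) :
    asymmetry (C : Set 𝔼) = jungNumber n / (1 - jungNumber n) := by
  have := nontrivial_euclideanSpace hn
  obtain ⟨hTC, hcomp, hdiam⟩ := hC
  obtain ⟨hD, v, hv, hTv⟩ := hT.exists_vertices hn
  rw [← hdiam] at hD hv
  exact asymmetry_eq_of_radii hn C (hcomp.outerRadius_add_innerRadius C.isCompact C.nonempty) hD
    (fun i => hTC (hTv ▸ subset_convexHull ℝ _ ⟨i, rfl⟩)) hv

lemma isGreatest_completeAsymmetries (hn : 1 ≤ n) :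
    IsGreatest (completeAsymmetries 𝔼) (jungNumber n / (1 - jungNumber n)) := by
  have := nontrivial_euclideanSpace hn
  refine ⟨?_, ?_⟩
  · obtain ⟨T, hT⟩ := exists_isRegularSimplex n
    obtain ⟨C, hC⟩ := exists_isCompletion T
    exact ⟨C, hC.2.1, (asymmetry_eq_of_isCompletion hn hT hC).symm⟩
  · rintro _ ⟨K, hK, rfl⟩
    exact (asymmetry_le_of_radii hn K
      (hK.outerRadius_add_innerRadius K.isCompact K.nonempty)).1

lemma asymmetryConstant_eq (hn : 1 ≤ n) :
    asymmetryConstant 𝔼 = jungNumber n / (1 - jungNumber n) :=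
  (isGreatest_completeAsymmetries hn).csSup_eq

lemma convexHull_range_subset (K : ConvexBody 𝔼) {v : Fin (n + 1) → 𝔼}
    (hvK : ∀ i, v i ∈ (K : Set 𝔼)) : convexHull ℝ (Set.range v) ⊆ (K : Set 𝔼) :=
  convexHull_min (by rintro _ ⟨i, rfl⟩; exact hvK i) K.convex

/-- The inclusions give K the diameter D of T, and the simplex forces R = jD for both. The ball in P
then gives r ≥ D - R. -/
lemma extremal_of_between (hn : 1 ≤ n) (K : ConvexBody 𝔼) {T P : Set 𝔼} {C : ConvexBody 𝔼}
    (hT : IsRegularSimplex T) (hP : IsPseudoCompletion T P) (hC : IsCompletion T C)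
    (hPK : P ⊆ (K : Set 𝔼)) (hKC : (K : Set 𝔼) ⊆ C) :
    asymmetry (K : Set 𝔼) = jungNumber n / (1 - jungNumber n) ∧
      outerRadius (K : Set 𝔼) + innerRadius (K : Set 𝔼) = Metric.diam (K : Set 𝔼) := by
  have := nontrivial_euclideanSpace hn
  obtain ⟨c, _, rfl⟩ := hP
  have hTK : T ⊆ (K : Set 𝔼) :=
    (Set.subset_union_left.trans (subset_convexHull ℝ _)).trans hPK
  have hBK : Metric.closedBall c (Metric.diam T - outerRadius T) ⊆ (K : Set 𝔼) :=
    (Set.subset_union_right.trans (subset_convexHull ℝ _)).trans hPK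
  have hKb := K.isCompact.isBounded
  have hdiam : Metric.diam (K : Set 𝔼) = Metric.diam T := le_antisymm
    (hC.2.2 ▸ Metric.diam_mono hKC C.isCompact.isBounded) (Metric.diam_mono hTK hKb)
  obtain ⟨hD, v, hv, hTv⟩ := hT.exists_vertices hn
  have hvT : ∀ i, v i ∈ T := fun i => hTv ▸ subset_convexHull ℝ _ ⟨i, rfl⟩
  have hTc : IsCompact T := hTv ▸ (Set.finite_range v).isCompact_convexHull ℝ
  have hRT := outerRadius_eq_jungNumber_mul hTc hD hv hvT
  have hRK := outerRadius_eq_jungNumber_mul K.isCompact (hdiam ▸ hD)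
    (fun i j hij => (hv i j hij).trans hdiam.symm) fun i => hTK (hvT i)
  have hr := le_innerRadius hKb hBK
  have hsum : outerRadius (K : Set 𝔼) + innerRadius (K : Set 𝔼) = Metric.diam (K : Set 𝔼) := by
    refine (outerRadius_add_innerRadius_le K.isCompact K.nonempty).antisymm ?_
    rw [hRK, hdiam]
    rw [hRT] at hr
    linarith
  exact ⟨asymmetry_eq_of_radii hn K hsum (hdiam ▸ hD) (fun i => hTK (hvT i))
    fun i j hij => (hv i j hij).trans hdiam.symm, hsum⟩

/-- T comes from equality in Jung's theorem and C is any completion of K. The common centre of the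
inball and circumball of K is a circumcenter of T, and D - R = r, so the ball added to T is the
inball of K. -/
lemma exists_between_of_extremal (hn : 1 ≤ n) (K : ConvexBody 𝔼)
    (hs : asymmetry (K : Set 𝔼) = jungNumber n / (1 - jungNumber n))
    (h : outerRadius (K : Set 𝔼) + innerRadius (K : Set 𝔼) = Metric.diam (K : Set 𝔼)) :
    ∃ (T P : Set 𝔼) (C : ConvexBody 𝔼), IsRegularSimplex T ∧ IsPseudoCompletion T P ∧
      IsCompletion T C ∧ P ⊆ (K : Set 𝔼) ∧ (K : Set 𝔼) ⊆ C := by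
  have := nontrivial_euclideanSpace hn
  obtain ⟨hD, v, hvK, hv⟩ := (asymmetry_le_of_radii hn K h).2 hs
  have hTK := convexHull_range_subset K hvK
  have hdiam := diam_convexHull_range hn hv
  have hvT : ∀ i, v i ∈ convexHull ℝ (Set.range v) := fun i => subset_convexHull ℝ _ ⟨i, rfl⟩
  obtain ⟨C, hKC, hC, hCK⟩ := exists_isCompletion K
  obtain ⟨c, h1, h2⟩ := exists_concentric_balls K.isCompact K.nonempty h
  have hRT := outerRadius_eq_jungNumber_mul ((Set.finite_range v).isCompact_convexHull ℝ)
    (hdiam ▸ hD) (hdiam ▸ hv) hvT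
  have hRK := outerRadius_eq_jungNumber_mul K.isCompact hD hv hvK
  have hR : outerRadius (convexHull ℝ (Set.range v)) = outerRadius (K : Set 𝔼) := by
    rw [hRT, hRK, hdiam]
  refine ⟨_, _, C, isRegularSimplex_of_dist_eq hD hv, ⟨c, ?_, rfl⟩,
    ⟨hTK.trans hKC, hC, hCK.trans hdiam.symm⟩, ?_, hKC⟩
  · rw [IsCircumcenter, hR]; exact hTK.trans h2
  · refine convexHull_min (Set.union_subset hTK ?_) K.convex
    rwa [hR, hdiam, ← h, add_sub_cancel_left]

lemma exists_isRegularSimplex_isCompletion (hn : 1 ≤ n) (K : ConvexBody 𝔼)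
    (hK : DiamComplete (K : Set 𝔼))
    (hs : asymmetry (K : Set 𝔼) = jungNumber n / (1 - jungNumber n)) :
    ∃ T : Set 𝔼, IsRegularSimplex T ∧ IsCompletion T K := by
  have := nontrivial_euclideanSpace hn
  obtain ⟨hD, v, hvK, hv⟩ := (asymmetry_le_of_radii hn K
    (hK.outerRadius_add_innerRadius K.isCompact K.nonempty)).2 hs
  exact ⟨_, isRegularSimplex_of_dist_eq hD hv, convexHull_range_subset K hvK, hK,
    (diam_convexHull_range hn hv).symm⟩

end Euclidean

end MinkowskiGeometry

theorem mainTheorem2 (n : ℕ) (hn : 1 ≤ n) :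
    -- the supremum and the maximum defining the two constants are genuine
    IsLUB (jungRatios (EuclideanSpace ℝ (Fin n))) (jungConstant (EuclideanSpace ℝ (Fin n))) ∧
    IsGreatest (completeAsymmetries (EuclideanSpace ℝ (Fin n)))
      (asymmetryConstant (EuclideanSpace ℝ (Fin n))) ∧
    -- their values
    asymmetryConstant (EuclideanSpace ℝ (Fin n)) =
      jungConstant (EuclideanSpace ℝ (Fin n)) / (1 - jungConstant (EuclideanSpace ℝ (Fin n))) ∧
    jungConstant (EuclideanSpace ℝ (Fin n)) / (1 - jungConstant (EuclideanSpace ℝ (Fin n))) =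
      ((n : ℝ) + √(2 * (n : ℝ) * ((n : ℝ) + 1))) / ((n : ℝ) + 2) ∧
    -- the extremal bodies
    (∀ K : ConvexBody (EuclideanSpace ℝ (Fin n)),
      (asymmetry (K : Set (EuclideanSpace ℝ (Fin n))) =
          asymmetryConstant (EuclideanSpace ℝ (Fin n)) ∧
        outerRadius (K : Set (EuclideanSpace ℝ (Fin n))) +
          innerRadius (K : Set (EuclideanSpace ℝ (Fin n))) =
          Metric.diam (K : Set (EuclideanSpace ℝ (Fin n)))) ↔
      ∃ (T Tplus : Set (EuclideanSpace ℝ (Fin n)))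
        (Tstar : ConvexBody (EuclideanSpace ℝ (Fin n))),
        IsRegularSimplex T ∧ IsPseudoCompletion T Tplus ∧ IsCompletion T Tstar ∧
          Tplus ⊆ (K : Set (EuclideanSpace ℝ (Fin n))) ∧
          (K : Set (EuclideanSpace ℝ (Fin n))) ⊆ (Tstar : Set (EuclideanSpace ℝ (Fin n)))) ∧
    -- the extremal bodies of constant width
    (∀ K : ConvexBody (EuclideanSpace ℝ (Fin n)),
      ConstantWidth (K : Set (EuclideanSpace ℝ (Fin n))) →
      (asymmetry (K : Set (EuclideanSpace ℝ (Fin n))) =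
          asymmetryConstant (EuclideanSpace ℝ (Fin n)) ↔
        ∃ T : Set (EuclideanSpace ℝ (Fin n)), IsRegularSimplex T ∧ IsCompletion T K)) := by
  have := nontrivial_euclideanSpace hn
  rw [asymmetryConstant_eq hn, jungConstant_eq hn]
  refine ⟨(isGreatest_jungRatios hn).isLUB, isGreatest_completeAsymmetries hn, rfl,
    jungNumber_div_one_sub n, fun K => ⟨?_, ?_⟩, fun K hK => ⟨fun hs => ?_, ?_⟩⟩
  · rintro ⟨hs, h⟩
    exact exists_between_of_extremal hn K hs h
  · rintro ⟨T, P, C, hT, hP, hC, hPK, hKC⟩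
    exact extremal_of_between hn K hT hP hC hPK hKC
  · exact exists_isRegularSimplex_isCompletion hn K hK.diamComplete hs
  · rintro ⟨T, hT, hC⟩
    exact asymmetry_eq_of_isCompletion hn hT hC
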